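/- Let $T=(V,E,F)$ be a finite simplicial complex of dimension at most two whose underlying space $|T|$ is a surface, possibly with boundary; $E$ is the set of edges, $F$ the set of triangles, and $V_b\subset V$ the set of boundary vertices. A corner is a pair $(v,f)$ of a vertex $v$ and a triangle $f\ni v$. An angle structure on $T$ is a positive function $\theta$ on the corners whose three values in each triangle add up to $\pi$, i.e. a vector in $\mathbb R^{3|F|}$. Its edge invariant $\alpha(\theta)\in\mathbb R^{E\cup V_b}$ is given as follows: for an edge $e$, $\alpha_e$ is the sum of the angles opposite to $e$ (two angles for an inner edge, one for a boundary edge); for a boundary vertex $v$, $\alpha_v$ is the sum of the angles at $v$. For $\bar\alpha\in\mathbb R^{E\cup V_b}$ let $\mathcal A(T,\bar\alpha)$ be the set of angle structures $\theta$ with $\alpha(\theta)=\bar\alpha$. Let $\mathcal A_0(T)$ be the set of angle structures $\theta$ with $\alpha(\theta)\in(0,\pi)^{E\cup V_b}$ and with angle sum $2\pi$ at every interior vertex, and let $\mathcal A_E(T)$ be the set of those $\theta\in\mathcal A_0(T)$ that are induced by a piecewise Euclidean metric, i.e. for which there is an edge length function $l\in\mathbb R_{>0}^E$ satisfying the strict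 triangle inequalities such that $\theta$ gives the inner angles of the Euclidean triangles with side lengths $l$. Both sets carry the subspace topology of $\mathbb R^{3|F|}$. The energy of an angle structure is $\mathcal E(\theta)=\sum_{f\in F}\bigl(\Lambda(\alpha_f)+\Lambda(\beta_f)+\Lambda(\gamma_f)\bigr)$, where $\alpha_f,\beta_f,\gamma_f$ are the angles of $f$ and $\Lambda(x)=-\int_0^x\log|2\sin t|\,dt$. **Lemma 2.2.** If $\mathcal A_E(T)$ is nonempty, then $\mathcal A_E(T)$ is homeomorphic to $\mathbb R^k$ for some integer $k\ge 0$. Moreover, for every $\bar\alpha\in\alpha(\mathcal A_0(T))$ the restriction of $\mathcal E$ to $\mathcal A(T,\bar\alpha)$ has exactly one critical point $\Theta(\bar\alpha)$, and $\bar\alpha\mapsto\Theta(\bar\alpha)$ is a homeomorphism from $\alpha(\mathcal A_0(T))\subset\mathbb R^{E\cup V_b}$ onto $\mathcal A_E(T)$. -/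

import Mathlib

open Topology

noncomputable section

namespace TriangulatedSurface

variable {V : Type*} [Fintype V] [DecidableEq V]

/-- The underlying space `|T|` of a finite simplicial complex on the vertex set `V`, in barycentric
coordinates: the points of the standard simplex of `V` whose support is a simplex of `T`. -/
def Realization (T : AbstractSimplicialComplex V) : Type _ :=
  {x : V → ℝ //
    x ∈ stdSimplex ℝ V ∧ Finset.univ.filter (fun v => x v ≠ 0) ∈ T.faces}

instance (T : AbstractSimplicialComplex V) : TopologicalSpace (Realization T) :=
  instTopologicalSpaceSubtype

/-- A vertex of `T`, as a point of `|T|`. -/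
def vertexPoint (T : AbstractSimplicialComplex V) (v : V) : Realization T :=
  ⟨Pi.single v 1, single_mem_stdSimplex ℝ v, by
    have h : Finset.univ.filter (fun w => (Pi.single v 1 : V → ℝ) w ≠ 0) = {v} := by
      ext w
      simp [Pi.single_apply]
    rw [h]
    exact T.singleton_mem v⟩

/-- `T` is a simplicial complex of dimension at most two, and its underlying space is a
surface, possibly with boundary: it is locally homeomorphic to the closed half plane. -/
structure IsSurface (T : AbstractSimplicialComplex V) : Prop where
  card_le_three : ∀ s ∈ T.faces, s.card ≤ 3
  locally_halfPlane : ∀ x : Realization T,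
    ∃ φ : OpenPartialHomeomorph (Realization T) (EuclideanHalfSpace 2), x ∈ φ.source

/-- A vertex is interior if some neighbourhood of it in `|T|` is homeomorphic to an open subset
of the plane. -/
def IsInteriorVertex (T : AbstractSimplicialComplex V) (v : V) : Prop :=
  ∃ φ : OpenPartialHomeomorph (Realization T) (EuclideanSpace ℝ (Fin 2)),
    vertexPoint T v ∈ φ.source

/-- The set `E` of edges. -/
abbrev Edge (T : AbstractSimplicialComplex V) : Type _ :=
  {e : Finset V // e ∈ T.faces ∧ e.card = 2}

/-- The set `F` of triangles. -/
abbrev Face (T : AbstractSimplicialComplex V) : Type _ :=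
  {f : Finset V // f ∈ T.faces ∧ f.card = 3}

/-- The set `V_b` of boundary vertices. -/
abbrev BoundaryVertex (T : AbstractSimplicialComplex V) : Type _ :=
  {v : V // ¬ IsInteriorVertex T v}

/-- The corners: pairs `(v, f)` of a vertex and a triangle containing it. -/
abbrev Corner (T : AbstractSimplicialComplex V) : Type _ :=
  {c : V × Face T // c.1 ∈ c.2.1}

instance (T : AbstractSimplicialComplex V) : Fintype (Edge T) := Fintype.ofFinite _
instance (T : AbstractSimplicialComplex V) : Fintype (Face T) := Fintype.ofFinite _
instance (T : AbstractSimplicialComplex V) : Fintype (Corner T) := Fintype.ofFinite _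

/-- The vertex of a corner. -/
abbrev Corner.vertex {T : AbstractSimplicialComplex V} (c : Corner T) : V := c.1.1

/-- The triangle of a corner. -/
abbrev Corner.face {T : AbstractSimplicialComplex V} (c : Corner T) : Face T := c.1.2

/-- The edge opposite to the corner `(v, f)`: the side of `f` that does not contain `v`. -/
def Corner.opposite {T : AbstractSimplicialComplex V} (c : Corner T) : Edge T :=
  have hcard : (c.face.1.erase c.vertex).card = 2 := by
    rw [Finset.card_erase_of_mem c.2, c.face.2.2]
  ⟨c.face.1.erase c.vertex,
    (T.isRelLowerSet_faces c.face.2.1).2 (Finset.erase_subset _ _)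
      (Finset.card_pos.1 (by omega)),
    hcard⟩

/-- The two sides of `f` at the vertex `v`, for a corner `(v, f)`. -/
def Corner.sides {T : AbstractSimplicialComplex V} (c : Corner T) : Finset (Edge T) :=
  Finset.univ.filter (fun e => c.vertex ∈ e.1 ∧ e.1 ⊆ c.face.1)

/-- The sum of the angles at the vertex `v`. -/
def angleSum (T : AbstractSimplicialComplex V) (θ : Corner T → ℝ) (v : V) : ℝ :=
  ∑ c : Corner T with c.vertex = v, θ c

/-- A Euclidean angle structure: a positive function on the corners, with sum `π` over the three
corners of every triangle. -/
structure IsAngleStructure (T : AbstractSimplicialComplex V) (θ : Corner T → ℝ) : Prop where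
  pos : ∀ c, 0 < θ c
  sum_face : ∀ f : Face T, ∑ c : Corner T with c.face = f, θ c = Real.pi

/-- The edge invariant `α(θ)`, indexed by `E ∪ V_b`. At an edge it is the sum of the angles
opposite to the edge (two for an inner edge, one for a boundary edge), at a boundary vertex it is
the sum of the angles at the vertex. -/
def edgeInvariant (T : AbstractSimplicialComplex V) (θ : Corner T → ℝ) :
    Edge T ⊕ BoundaryVertex T → ℝ
  | Sum.inl e => ∑ c : Corner T with c.opposite = e, θ c
  | Sum.inr v => angleSum T θ v.1

/-- The set `A(T, a)` of angle structures with edge invariant `a`. -/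
def anglesWithInvariant (T : AbstractSimplicialComplex V)
    (a : Edge T ⊕ BoundaryVertex T → ℝ) : Set (Corner T → ℝ) :=
  {θ | IsAngleStructure T θ ∧ edgeInvariant T θ = a}

/-- An edge length function of a piecewise Euclidean metric: positive, with the strict triangle
inequalities in every triangle. -/
structure IsEdgeLength (T : AbstractSimplicialComplex V) (l : Edge T → ℝ) : Prop where
  pos : ∀ e, 0 < l e
  triangle : ∀ c : Corner T, l c.opposite < ∑ e ∈ c.sides, l e

/-- The inner angle at the corner `c` of the Euclidean triangle with the side lengths given by `l`:
`arccos ((x ^ 2 + y ^ 2 - z ^ 2) / (2 * x * y))`, where `x`, `y` are the lengths of the sides at the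
corner and `z` is the length of the opposite side. -/
def inducedAngle (T : AbstractSimplicialComplex V) (l : Edge T → ℝ) (c : Corner T) : ℝ :=
  Real.arccos (((∑ e ∈ c.sides, l e ^ 2) - l c.opposite ^ 2) / (2 * ∏ e ∈ c.sides, l e))

/-- The set `A_0(T)`: angle structures with edge invariants in `(0, π)` and angle sum `2π` at every
interior vertex. -/
def A0 (T : AbstractSimplicialComplex V) : Set (Corner T → ℝ) :=
  {θ | IsAngleStructure T θ ∧ (∀ i, edgeInvariant T θ i ∈ Set.Ioo 0 Real.pi) ∧
    ∀ v, IsInteriorVertex T v → angleSum T θ v = 2 * Real.pi}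

/-- The set `A_E(T)`: the elements of `A_0(T)` that are induced by a piecewise Euclidean metric. -/
def AE (T : AbstractSimplicialComplex V) : Set (Corner T → ℝ) :=
  {θ | θ ∈ A0 T ∧ ∃ l : Edge T → ℝ, IsEdgeLength T l ∧ θ = inducedAngle T l}

/-- The Lobachevsky function. -/
def lobachevsky (x : ℝ) : ℝ := -∫ t in (0 : ℝ)..x, Real.log |2 * Real.sin t|

/-- The energy of an angle structure: the sum over the triangles of the volume
`Λ(α) + Λ(β) + Λ(γ)` of the ideal tetrahedron with the angles of the triangle. -/
def energy (T : AbstractSimplicialComplex V) (θ : Corner T → ℝ) : ℝ :=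
  ∑ f : Face T, ∑ c : Corner T with c.face = f, lobachevsky (θ c)

/-- `θ` is a critical point of the energy on `A(T, a)`: it lies in `A(T, a)`, and the derivative of
the energy at `θ` vanishes in every direction `w` that is tangent to `A(T, a)`. -/
def IsCriticalPoint (T : AbstractSimplicialComplex V) (a : Edge T ⊕ BoundaryVertex T → ℝ)
    (θ : Corner T → ℝ) : Prop :=
  θ ∈ anglesWithInvariant T a ∧
    ∀ w : Corner T → ℝ, (∀ f : Face T, ∑ c : Corner T with c.face = f, w c = 0) →
      edgeInvariant T w = 0 →
      HasDerivAt (fun t : ℝ => energy T (θ + t • w)) 0 0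

end TriangulatedSurface

end

/-!
The critical points of the energy are exactly the angle structures of Euclidean triangles, and the
energy is strictly concave on every fibre `A(T, a)` of the edge invariant.

On `(0, π)` the derivative of the Lobachevsky function is `-log (2 sin x)`, so `θ` is critical in its
fibre if and only if the functional `w ↦ ∑ log (2 sin θ_c) w_c` vanishes on the tangent vectors. By
duality this means `log (2 sin θ_c) = m_f + u_e` for a corner `c` of `f` opposite to `e`, which is
the sine law for the edge lengths `exp u_e` (`mem_AE_of_isCriticalPoint`, `isCriticalPoint_of_mem_AE`).
The angle sum at any vertex is a combination of the edge invariants and of the angle sums of the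
triangles (`angleSum_eq`). Hence the constraints at the boundary vertices are redundant, and a fibre
over a point of `α(A_0)` lies in `A_0`.

A fibre has at most one critical point because the second derivative of the energy is negative
definite in every triangle (`cot_quadratic_pos`, `IsCriticalPoint.unique`). It has one because the
energy attains a maximum on the compact fibre in which angles may vanish. The edge invariants are less
than `π`, so no angle is `π` there, and the derivative of the energy is infinite where an angle
vanishes (`exists_energy_lt`); hence the maximizer is a genuine angle structure and critical.

Limits of maximizers are maximizers, since the edge invariant has a linear section on its image; so
the critical point depends continuously on the edge invariant (`continuous_criticalPoint`). Its inverse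
is the restriction of the linear map `α`. Finally `α(A_0)` is a bounded convex relatively open subset
of an affine space, hence an open cell (`exists_homeomorph_image_A0`), and so is `A_E`.
-/

open Topology

noncomputable section

namespace TriangulatedSurface

/-! ### Corners of a triangle -/

theorem Face.exists_corner {V : Type*} {T : AbstractSimplicialComplex V} (f : Face T) :
    ∃ c : Corner T, c.face = f := by
  obtain ⟨v, hv⟩ := Finset.card_pos.1 (show 0 < f.1.card by rw [f.2.2]; norm_num)
  exact ⟨⟨(v, f), hv⟩, rfl⟩

variable {V : Type*} [Fintype V] [DecidableEq V]

/-- The other two corners of the triangle of a corner; the sides at a corner are the edges opposite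
to the other two. -/
theorem Corner.exists_triple {T : AbstractSimplicialComplex V} (c : Corner T) :
    ∃ d e : Corner T, c ≠ d ∧ c ≠ e ∧ d ≠ e ∧
      (Finset.univ.filter fun x : Corner T => x.face = c.face) = {c, d, e} ∧
      c.sides = {d.opposite, e.opposite} ∧ d.opposite ≠ e.opposite := by
  obtain ⟨⟨v, f, hf, h3⟩, hv⟩ := c
  change v ∈ f at hv
  have h2 : (f.erase v).card = 2 := by rw [Finset.card_erase_of_mem hv, h3]
  obtain ⟨u, w, huw, huwf⟩ := Finset.card_eq_two.1 h2
  have hu : u ∈ f.erase v := by simp [huwf]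
  have hw : w ∈ f.erase v := by simp [huwf]
  rw [Finset.mem_erase] at hu hw
  have hfe : f = {v, u, w} := by rw [← Finset.insert_erase hv, huwf]
  have hopp : ({v, w} : Finset V) ≠ {v, u} := by
    intro h
    have : w ∈ ({v, u} : Finset V) := by simp [← h]
    simp [hw.1, huw.symm] at this
  have e1 : f.erase u = {v, w} := by
    ext x
    rw [hfe]
    simp only [Finset.mem_erase, Finset.mem_insert, Finset.mem_singleton]
    grind
  have e2 : f.erase w = {v, u} := by
    ext x
    rw [hfe]
    simp only [Finset.mem_erase, Finset.mem_insert, Finset.mem_singleton]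
    grind
  refine ⟨⟨(u, ⟨f, hf, h3⟩), hu.2⟩, ⟨(w, ⟨f, hf, h3⟩), hw.2⟩, ?_, ?_, ?_, ?_, ?_, ?_⟩
  · simpa [Subtype.ext_iff, Prod.ext_iff] using hu.1.symm
  · simpa [Subtype.ext_iff, Prod.ext_iff] using hw.1.symm
  · simpa [Subtype.ext_iff, Prod.ext_iff] using huw
  · ext ⟨⟨x, g, hg, hg3⟩, hx⟩
    simp only [Finset.mem_filter, Finset.mem_univ, true_and, Finset.mem_insert,
      Finset.mem_singleton, Subtype.ext_iff, Prod.ext_iff, Corner.face]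
    constructor
    · intro h
      have hx' : x ∈ f := by rw [← h]; exact hx
      simp only [hfe, Finset.mem_insert, Finset.mem_singleton] at hx'
      tauto
    · tauto
  · ext ⟨s, hs, hs2⟩
    simp only [Corner.sides, Corner.opposite, Finset.mem_filter, Finset.mem_univ, true_and,
      Finset.mem_insert, Finset.mem_singleton, Subtype.ext_iff, Corner.vertex, e1, e2]
    constructor
    · rintro ⟨hvs, hsf⟩
      obtain ⟨x, hx⟩ := Finset.card_eq_one.1
        (show (s.erase v).card = 1 by rw [Finset.card_erase_of_mem hvs, hs2])
      have hxs : x ∈ s.erase v := by simp [hx]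
      have hxf : x ∈ f.erase v := Finset.erase_subset_erase v hsf hxs
      rw [← Finset.insert_erase hvs, hx]
      rw [huwf, Finset.mem_insert, Finset.mem_singleton] at hxf
      rcases hxf with rfl | rfl
      · exact Or.inr rfl
      · exact Or.inl rfl
    · rintro (rfl | rfl)
      · exact ⟨by simp, by rw [← e1]; exact Finset.erase_subset _ _⟩
      · exact ⟨by simp, by rw [← e2]; exact Finset.erase_subset _ _⟩
  · simpa only [Corner.opposite, ne_eq, Subtype.ext_iff, Corner.face, Corner.vertex, e1, e2]
      using hopp

theorem sum_corners_eq_sum_faces {T : AbstractSimplicialComplex V} (g : Corner T → ℝ) :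
    ∑ c, g c = ∑ f : Face T, ∑ c : Corner T with c.face = f, g c :=
  (Finset.sum_fiberwise _ _ _).symm

/-- The angle sum at a vertex, interior or not, is determined by the angle sums of the triangles and
by the sums opposite to the edges: in a triangle at `v`, the sides opposite to the two other corners
are the two sides that contain `v`. -/
theorem angleSum_eq {T : AbstractSimplicialComplex V} (θ : Corner T → ℝ) (v : V) :
    angleSum T θ v = ∑ f : Face T with v ∈ f.1, ∑ c : Corner T with c.face = f, θ c -
      ∑ e : Edge T with v ∈ e.1, ∑ c : Corner T with c.opposite = e, θ c := by
  have h1 : ∑ f : Face T with v ∈ f.1, ∑ c : Corner T with c.face = f, θ c =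
      ∑ c : Corner T, if v ∈ c.face.1 then θ c else 0 := by
    rw [sum_corners_eq_sum_faces, Finset.sum_filter]
    refine Finset.sum_congr rfl fun f _ => ?_
    split_ifs with h
    · refine Finset.sum_congr rfl fun c hc => ?_
      rw [Finset.mem_filter] at hc
      rw [if_pos (by rw [hc.2]; exact h)]
    · refine (Finset.sum_eq_zero fun c hc => ?_).symm
      rw [Finset.mem_filter] at hc
      rw [if_neg (by rw [hc.2]; exact h)]
  have h2 : ∑ e : Edge T with v ∈ e.1, ∑ c : Corner T with c.opposite = e, θ c =
      ∑ c : Corner T, if v ∈ c.opposite.1 then θ c else 0 := by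
    rw [← Finset.sum_fiberwise Finset.univ Corner.opposite, Finset.sum_filter]
    refine Finset.sum_congr rfl fun f _ => ?_
    split_ifs with h
    · refine Finset.sum_congr rfl fun c hc => ?_
      rw [Finset.mem_filter] at hc
      rw [if_pos (by rw [hc.2]; exact h)]
    · refine (Finset.sum_eq_zero fun c hc => ?_).symm
      rw [Finset.mem_filter] at hc
      rw [if_neg (by rw [hc.2]; exact h)]
  rw [h1, h2, ← Finset.sum_sub_distrib, angleSum, Finset.sum_filter]
  refine Finset.sum_congr rfl fun c _ => ?_
  have hc := c.2
  by_cases h : c.vertex = v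
  · have : v ∈ c.face.1 := h ▸ hc
    simp [Corner.opposite, h, this]
  · have h' : v ≠ c.vertex := fun h' => h h'.symm
    simp [Corner.opposite, h, h']

/-! ### The Lobachevsky function -/

theorem intervalIntegrable_log_abs_two_mul_sin (a b : ℝ) :
    IntervalIntegrable (fun t => Real.log |2 * Real.sin t|) MeasureTheory.volume a b := by
  have : MeromorphicOn (fun t : ℝ => 2 * Real.sin t) (Set.uIcc a b) := fun t _ =>
    (analyticAt_const.mul Real.analyticAt_sin).meromorphicAt
  simpa [Real.norm_eq_abs] using this.intervalIntegrable_log_norm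

theorem hasDerivAt_lobachevsky {x : ℝ} (h : 0 < Real.sin x) :
    HasDerivAt lobachevsky (-Real.log (2 * Real.sin x)) x := by
  have hc : ContinuousAt (fun t : ℝ => Real.log |2 * Real.sin t|) x :=
    ContinuousAt.log (by fun_prop) (by positivity)
  have hm : StronglyMeasurableAtFilter (fun t : ℝ => Real.log |2 * Real.sin t|) (𝓝 x) :=
    Measurable.stronglyMeasurable (by fun_prop) |>.stronglyMeasurableAtFilter
  have := (intervalIntegral.integral_hasDerivAt_right
    (intervalIntegrable_log_abs_two_mul_sin 0 x) hm hc).neg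
  rwa [abs_of_pos (by positivity : 0 < 2 * Real.sin x)] at this

theorem continuous_lobachevsky : Continuous lobachevsky :=
  (intervalIntegral.continuous_primitive intervalIntegrable_log_abs_two_mul_sin 0).neg

/-! ### Trigonometry of a triangle -/

/-- The quadratic form `∑ cot A * a ^ 2` is positive definite on the plane `a + b + c = 0`: its
determinant there is `cot A cot B + cot B cot C + cot C cot A = 1`. -/
theorem cot_quadratic_pos {A B C a b c : ℝ} (hA : 0 < A) (hB : 0 < B) (hC : 0 < C)
    (hsum : A + B + C = Real.pi) (h0 : a + b + c = 0) (hne : ¬(a = 0 ∧ b = 0 ∧ c = 0)) :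
    0 < Real.cos A / Real.sin A * a ^ 2 + Real.cos B / Real.sin B * b ^ 2 +
      Real.cos C / Real.sin C * c ^ 2 := by
  have sA : 0 < Real.sin A := Real.sin_pos_of_pos_of_lt_pi hA (by linarith)
  have sB : 0 < Real.sin B := Real.sin_pos_of_pos_of_lt_pi hB (by linarith)
  have sC : 0 < Real.sin C := Real.sin_pos_of_pos_of_lt_pi hC (by linarith)
  have hBs : Real.sin A * Real.cos C + Real.cos A * Real.sin C = Real.sin B := by
    rw [← Real.sin_add, ← Real.sin_pi_sub]
    congr 1
    linarith
  have hBc : Real.cos B = Real.sin A * Real.sin C - Real.cos A * Real.cos C := by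
    have : B = Real.pi - (A + C) := by linarith
    rw [this, Real.cos_pi_sub, Real.cos_add]
    ring
  obtain rfl : c = -a - b := by linarith
  have hpr : 0 < Real.cos A / Real.sin A + Real.cos C / Real.sin C := by
    have : Real.cos A / Real.sin A + Real.cos C / Real.sin C =
        Real.sin B / (Real.sin A * Real.sin C) := by
      rw [← hBs]
      field_simp
      ring
    rw [this]
    positivity
  have hdet : Real.cos A / Real.sin A * (Real.cos B / Real.sin B) +
      Real.cos B / Real.sin B * (Real.cos C / Real.sin C) +
      Real.cos C / Real.sin C * (Real.cos A / Real.sin A) = 1 := by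
    field_simp
    rw [← hBs, hBc]
    ring
  set p := Real.cos A / Real.sin A
  set q := Real.cos B / Real.sin B
  set r := Real.cos C / Real.sin C
  refine pos_of_mul_pos_right (a := p + r) ?_ hpr.le
  have key : (p + r) * (p * a ^ 2 + q * b ^ 2 + r * (-a - b) ^ 2) =
      ((p + r) * a + r * b) ^ 2 + (p * q + q * r + r * p) * b ^ 2 := by ring
  rw [key, hdet]
  by_cases hb : b = 0
  · have ha : a ≠ 0 := fun ha => hne ⟨ha, hb, by simp [ha, hb]⟩
    subst hb
    have := mul_ne_zero hpr.ne' ha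
    simp only [mul_zero, add_zero, ne_eq, OfNat.ofNat_ne_zero, not_false_eq_true, zero_pow]
    positivity
  · positivity

/-- The inner angle at `z` computed from the side lengths has sine proportional to `z`, and the
factor `√(p₂ ^ 2 - 2 * p₄) / (2 * x * y * z)`, with `p₂` and `p₄` the power sums of the side lengths,
is the same at the three corners. -/
theorem sin_arccos_of_sides {x y z : ℝ} (hx : 0 < x) (hy : 0 < y) (hz : 0 < z) :
    Real.sin (Real.arccos ((x ^ 2 + y ^ 2 - z ^ 2) / (2 * (x * y)))) =
      z * (√((z ^ 2 + x ^ 2 + y ^ 2) ^ 2 - 2 * (z ^ 4 + x ^ 4 + y ^ 4)) / (2 * (z * x * y))) := by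
  have h1 : 1 - ((x ^ 2 + y ^ 2 - z ^ 2) / (2 * (x * y))) ^ 2 =
      ((z ^ 2 + x ^ 2 + y ^ 2) ^ 2 - 2 * (z ^ 4 + x ^ 4 + y ^ 4)) / (2 * (x * y)) ^ 2 := by
    field_simp
    ring
  rw [Real.sin_arccos, h1, Real.sqrt_div' _ (by positivity), Real.sqrt_sq (by positivity)]
  field_simp

/-- A triangle whose sides are proportional to the sines of the angles has those angles. -/
theorem arccos_of_sines {A B C k : ℝ} (hA : 0 < A) (hB : 0 < B) (hC : 0 < C)
    (hsum : A + B + C = Real.pi) (hk : 0 < k) :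
    Real.arccos (((k * Real.sin B) ^ 2 + (k * Real.sin C) ^ 2 - (k * Real.sin A) ^ 2) /
      (2 * ((k * Real.sin B) * (k * Real.sin C)))) = A := by
  have sB : 0 < Real.sin B := Real.sin_pos_of_pos_of_lt_pi hB (by linarith)
  have sC : 0 < Real.sin C := Real.sin_pos_of_pos_of_lt_pi hC (by linarith)
  have hA' : A = Real.pi - (B + C) := by linarith
  have : ((k * Real.sin B) ^ 2 + (k * Real.sin C) ^ 2 - (k * Real.sin A) ^ 2) /
      (2 * ((k * Real.sin B) * (k * Real.sin C))) = Real.cos A := by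
    rw [hA', Real.sin_pi_sub, Real.cos_pi_sub, Real.sin_add, Real.cos_add]
    field_simp
    have hb := Real.sin_sq_add_cos_sq B
    have hc := Real.sin_sq_add_cos_sq C
    have hb' : Real.cos B ^ 2 = 1 - Real.sin B ^ 2 := by linarith
    have hc' : Real.cos C ^ 2 = 1 - Real.sin C ^ 2 := by linarith
    ring_nf
    rw [hb', hc']
    ring
  rw [this, Real.arccos_cos hA.le (by linarith)]

theorem sin_lt_sin_add_sin {A B C : ℝ} (hA : 0 < A) (hB : 0 < B) (hC : 0 < C)
    (hsum : A + B + C = Real.pi) : Real.sin A < Real.sin B + Real.sin C := by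
  have sB : 0 < Real.sin B := Real.sin_pos_of_pos_of_lt_pi hB (by linarith)
  have sC : 0 < Real.sin C := Real.sin_pos_of_pos_of_lt_pi hC (by linarith)
  have cos_lt {x : ℝ} (h0 : 0 < x) (h1 : x < Real.pi) : Real.cos x < 1 := by
    rw [← Real.cos_zero]
    exact Real.cos_lt_cos_of_nonneg_of_le_pi le_rfl h1.le h0
  have hA' : A = Real.pi - (B + C) := by linarith
  rw [hA', Real.sin_pi_sub, Real.sin_add]
  have := mul_pos sB (sub_pos.2 (cos_lt hC (by linarith)))
  have := mul_pos sC (sub_pos.2 (cos_lt hB (by linarith)))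
  linarith

/-! ### The linear constraints -/

/-- The edge invariant, as a linear map. -/
def edgeInvariantLinear (T : AbstractSimplicialComplex V) :
    (Corner T → ℝ) →ₗ[ℝ] (Edge T ⊕ BoundaryVertex T → ℝ) where
  toFun := edgeInvariant T
  map_add' x y := by
    funext i
    cases i <;> simp [edgeInvariant, angleSum, Finset.sum_add_distrib]
  map_smul' r x := by
    funext i
    cases i <;> simp [edgeInvariant, angleSum, Finset.mul_sum]

theorem edgeInvariantLinear_apply (T : AbstractSimplicialComplex V) (θ : Corner T → ℝ) :
    edgeInvariantLinear T θ = edgeInvariant T θ := rfl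

/-- The angle sums of the triangles, as a linear map. -/
def faceSum (T : AbstractSimplicialComplex V) : (Corner T → ℝ) →ₗ[ℝ] (Face T → ℝ) where
  toFun θ f := ∑ c : Corner T with c.face = f, θ c
  map_add' x y := by
    funext i
    simp [Finset.sum_add_distrib]
  map_smul' r x := by
    funext i
    simp [Finset.mul_sum]

theorem faceSum_apply (T : AbstractSimplicialComplex V) (θ : Corner T → ℝ) (f : Face T) :
    faceSum T θ f = ∑ c : Corner T with c.face = f, θ c := rfl

theorem angleSum_congr {T : AbstractSimplicialComplex V} {θ η : Corner T → ℝ}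
    (hf : faceSum T θ = faceSum T η) (he : edgeInvariant T θ = edgeInvariant T η) (v : V) :
    angleSum T θ v = angleSum T η v := by
  have h1 : ∀ f : Face T, _ := fun f => congrFun hf f
  have h2 : ∀ e : Edge T, _ := fun e => congrFun he (Sum.inl e)
  simp only [faceSum_apply, edgeInvariant] at h1 h2
  simp only [angleSum_eq, h1, h2]

variable {T : AbstractSimplicialComplex V} {θ η : Corner T → ℝ}
  {a : Edge T ⊕ BoundaryVertex T → ℝ}

theorem IsAngleStructure.faceSum_eq (h : IsAngleStructure T θ) :
    faceSum T θ = fun _ => Real.pi := funext h.sum_face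

theorem IsAngleStructure.lt_pi (h : IsAngleStructure T θ) (c : Corner T) : θ c < Real.pi := by
  obtain ⟨d, e, hcd, hce, hde, hf, -, -⟩ := c.exists_triple
  have := h.sum_face c.face
  rw [hf, Finset.sum_insert (by simp [hcd, hce]), Finset.sum_pair hde] at this
  linarith [h.pos d, h.pos e]

theorem IsAngleStructure.sin_pos (h : IsAngleStructure T θ) (c : Corner T) :
    0 < Real.sin (θ c) :=
  Real.sin_pos_of_pos_of_lt_pi (h.pos c) (h.lt_pi c)

/-- The interior angle sums are functions of the edge invariant, so that the fibres of the edge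
invariant over `α(A_0)` lie in `A_0`. -/
theorem anglesWithInvariant_subset_A0 (hθ : θ ∈ A0 T) :
    anglesWithInvariant T (edgeInvariant T θ) ⊆ A0 T := by
  rintro η ⟨hη, he⟩
  refine ⟨hη, fun i => he ▸ hθ.2.1 i, fun v hv => ?_⟩
  rw [angleSum_congr (hη.faceSum_eq.trans hθ.1.faceSum_eq.symm) he]
  exact hθ.2.2 v hv

/-! ### Critical points of the energy -/

theorem energy_eq (θ : Corner T → ℝ) : energy T θ = ∑ c, lobachevsky (θ c) :=
  (sum_corners_eq_sum_faces _).symm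

theorem continuous_energy : Continuous (energy T) := by
  rw [show energy T = fun θ => ∑ c, lobachevsky (θ c) from funext energy_eq]
  exact continuous_finsetSum _ fun c _ => continuous_lobachevsky.comp (continuous_apply c)

theorem hasDerivAt_energy {w : Corner T → ℝ} {t : ℝ}
    (h : ∀ c, 0 < Real.sin (θ c + t * w c)) :
    HasDerivAt (fun t : ℝ => energy T (θ + t • w))
      (∑ c, -Real.log (2 * Real.sin (θ c + t * w c)) * w c) t := by
  simp only [energy_eq, Pi.add_apply, Pi.smul_apply, smul_eq_mul]
  refine HasDerivAt.fun_sum fun c _ => ?_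
  have : HasDerivAt (fun t : ℝ => θ c + t * w c) (w c) t := by
    simpa using ((hasDerivAt_id t).mul_const (w c)).const_add (θ c)
  exact HasDerivAt.comp (h₂ := lobachevsky) t (hasDerivAt_lobachevsky (h c)) this

theorem isCriticalPoint_iff :
    IsCriticalPoint T a θ ↔ θ ∈ anglesWithInvariant T a ∧
      ∀ w : Corner T → ℝ, faceSum T w = 0 → edgeInvariant T w = 0 →
        ∑ c, Real.log (2 * Real.sin (θ c)) * w c = 0 := by
  refine and_congr_right fun hθ => forall_congr' fun w => ?_
  have hd : HasDerivAt (fun t : ℝ => energy T (θ + t • w))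
      (-∑ c, Real.log (2 * Real.sin (θ c)) * w c) 0 := by
    have := hasDerivAt_energy (θ := θ) (w := w) (t := 0)
      (fun c => by simpa using hθ.1.sin_pos c)
    simpa [Finset.sum_neg_distrib] using this
  have hf : faceSum T w = 0 ↔ ∀ f : Face T, ∑ c : Corner T with c.face = f, w c = 0 := funext_iff
  refine imp_congr hf.symm (imp_congr_right fun _ => ?_)
  constructor
  · intro h
    exact neg_eq_zero.1 (hd.unique h)
  · intro h
    rwa [h, neg_zero] at hd

/-- The Lagrange multipliers of the edges at a critical point are the logarithms of edge lengths that
induce it. The multipliers of the boundary vertices are redundant by `angleSum_eq`. -/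
theorem mem_AE_of_isCriticalPoint (h : IsCriticalPoint T a θ) (h0 : θ ∈ A0 T) : θ ∈ AE T := by
  obtain ⟨-, hcrit⟩ := isCriticalPoint_iff.1 h
  -- By duality the differential of the energy is a combination of the constraints.
  let L : Face T ⊕ Edge T → (Corner T → ℝ) →ₗ[ℝ] ℝ := Sum.elim
    (fun f => LinearMap.proj f ∘ₗ faceSum T)
    (fun e => LinearMap.proj (Sum.inl e) ∘ₗ edgeInvariantLinear T)
  let K : (Corner T → ℝ) →ₗ[ℝ] ℝ :=
    ∑ c, Real.log (2 * Real.sin (θ c)) • LinearMap.proj c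
  have hK : ∀ w, K w = ∑ c, Real.log (2 * Real.sin (θ c)) * w c := by
    intro w
    simp [K, LinearMap.sum_apply]
  have hle : ⨅ i, LinearMap.ker (L i) ≤ LinearMap.ker K := by
    intro w hw
    rw [Submodule.mem_iInf] at hw
    have hf : faceSum T w = 0 := funext fun f => hw (Sum.inl f)
    have he : ∀ e, edgeInvariant T w (Sum.inl e) = 0 := fun e => hw (Sum.inr e)
    rw [LinearMap.mem_ker, hK]
    refine hcrit w hf (funext fun i => ?_)
    cases i with
    | inl e => exact he e
    | inr v =>
      have hf' : ∀ f : Face T, ∑ c : Corner T with c.face = f, w c = 0 := congrFun hf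
      simp only [edgeInvariant] at he
      simp [edgeInvariant, angleSum_eq, hf', he]
  obtain ⟨m, hm⟩ := (Submodule.mem_span_range_iff_exists_fun ℝ).1 (mem_span_of_iInf_ker_le_ker hle)
  -- Evaluation at the coordinate vectors gives the sine law in logarithmic form.
  have hlog : ∀ c, Real.log (2 * Real.sin (θ c)) = m (Sum.inl c.face) + m (Sum.inr c.opposite) := by
    intro c
    have h1 := LinearMap.congr_fun hm (Pi.single c 1)
    rw [hK] at h1
    simpa [L, LinearMap.sum_apply, Pi.single_apply, faceSum_apply, edgeInvariantLinear_apply, edgeInvariant,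
      Finset.sum_ite_eq, Finset.sum_filter] using h1.symm
  let l : Edge T → ℝ := fun e => Real.exp (m (Sum.inr e))
  have hl : ∀ c, l c.opposite = 2 * Real.exp (-m (Sum.inl c.face)) * Real.sin (θ c) := by
    intro c
    have := Real.exp_log (by have := h0.1.sin_pos c; positivity : 0 < 2 * Real.sin (θ c))
    rw [hlog, Real.exp_add] at this
    rw [mul_right_comm, ← this, mul_right_comm, ← Real.exp_add]
    simp [l]
  refine ⟨h0, l, ⟨fun e => Real.exp_pos _, fun c => ?_⟩, funext fun c => ?_⟩ <;>
    obtain ⟨d, e, hcd, hce, hde, hf, hs, hne⟩ := c.exists_triple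
  all_goals
    have hsum := h0.1.sum_face c.face
    rw [hf, Finset.sum_insert (by simp [hcd, hce]), Finset.sum_pair hde, ← add_assoc] at hsum
    have hdf : d.face = c.face := by
      have : d ∈ Finset.univ.filter fun x : Corner T => x.face = c.face := by simp [hf]
      exact (Finset.mem_filter.1 this).2
    have hef : e.face = c.face := by
      have : e ∈ Finset.univ.filter fun x : Corner T => x.face = c.face := by simp [hf]
      exact (Finset.mem_filter.1 this).2
    have hk : 0 < 2 * Real.exp (-m (Sum.inl c.face)) := by positivity
  · rw [hs, Finset.sum_pair hne, hl, hl, hl, hdf, hef, ← mul_add]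
    exact mul_lt_mul_of_pos_left
      (sin_lt_sin_add_sin (h0.1.pos c) (h0.1.pos d) (h0.1.pos e) hsum) hk
  · rw [inducedAngle, hs, Finset.sum_pair hne, Finset.prod_pair hne, hl, hl, hl, hdf, hef,
      arccos_of_sines (h0.1.pos c) (h0.1.pos d) (h0.1.pos e) hsum hk]

/-- In each triangle the sine law `log sin θ_c = log l_e + const` splits the differential of the
energy into the edge invariant and the angle sums of the triangles. -/
theorem isCriticalPoint_of_mem_AE (h : θ ∈ AE T) :
    IsCriticalPoint T (edgeInvariant T θ) θ := by
  obtain ⟨h0, l, hl, hθ⟩ := h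
  refine isCriticalPoint_iff.2 ⟨⟨h0.1, rfl⟩, fun w hwf hwe => ?_⟩
  -- `K f` is the reciprocal of the diameter of the circumcircle of `f`.
  let K : Face T → ℝ := fun f =>
    √((∑ c : Corner T with c.face = f, l c.opposite ^ 2) ^ 2 -
      2 * ∑ c : Corner T with c.face = f, l c.opposite ^ 4) /
      (2 * ∏ c : Corner T with c.face = f, l c.opposite)
  have hsin : ∀ c : Corner T, Real.sin (θ c) = l c.opposite * K c.face := by
    intro c
    obtain ⟨d, e, hcd, hce, hde, hf, hs, hne⟩ := c.exists_triple
    have hc : c ∉ ({d, e} : Finset (Corner T)) := by simp [hcd, hce]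
    have := sin_arccos_of_sides (hl.pos d.opposite) (hl.pos e.opposite) (hl.pos c.opposite)
    rw [hθ, inducedAngle, hs, Finset.sum_pair hne, Finset.prod_pair hne, this]
    simp only [K]
    rw [hf, Finset.sum_insert hc, Finset.sum_insert hc, Finset.prod_insert hc,
      Finset.sum_pair hde, Finset.sum_pair hde, Finset.prod_pair hde]
    simp only [add_assoc, mul_assoc]
  have hlog : ∀ c, Real.log (2 * Real.sin (θ c)) =
      Real.log (l c.opposite) + Real.log (2 * K c.face) := by
    intro c
    have hs := h0.1.sin_pos c
    rw [hsin] at hs ⊢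
    have hK := pos_of_mul_pos_right hs (hl.pos _).le
    rw [mul_left_comm, Real.log_mul (hl.pos _).ne' (by positivity)]
  simp only [hlog, add_mul, Finset.sum_add_distrib]
  have h1 : ∑ c : Corner T, Real.log (l c.opposite) * w c = 0 := by
    rw [← Finset.sum_fiberwise Finset.univ Corner.opposite]
    refine Finset.sum_eq_zero fun e _ => ?_
    have h2 : ∑ c : Corner T with c.opposite = e, w c = 0 := congrFun hwe (Sum.inl e)
    calc _ = ∑ c : Corner T with c.opposite = e, Real.log (l e) * w c :=
          Finset.sum_congr rfl fun c hc => by rw [(Finset.mem_filter.1 hc).2]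
      _ = 0 := by rw [← Finset.mul_sum, h2, mul_zero]
  have h3 : ∑ c : Corner T, Real.log (2 * K c.face) * w c = 0 := by
    rw [sum_corners_eq_sum_faces]
    refine Finset.sum_eq_zero fun f _ => ?_
    have h2 : ∑ c : Corner T with c.face = f, w c = 0 := congrFun hwf f
    calc _ = ∑ c : Corner T with c.face = f, Real.log (2 * K f) * w c :=
          Finset.sum_congr rfl fun c hc => by rw [(Finset.mem_filter.1 hc).2]
      _ = 0 := by rw [← Finset.mul_sum, h2, mul_zero]
  rw [h1, h3, add_zero]

theorem IsAngleStructure.lineMap (hθ : IsAngleStructure T θ) (hη : IsAngleStructure T η) {t : ℝ}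
    (h0 : 0 ≤ t) (h1 : t ≤ 1) : IsAngleStructure T (θ + t • (η - θ)) := by
  have hpos : ∀ c, 0 < (θ + t • (η - θ)) c := by
    intro c
    have h2 : (θ + t • (η - θ)) c = (1 - t) * θ c + t * η c := by
      simp
      ring
    rw [h2]
    rcases h0.eq_or_lt with rfl | h0
    · simpa using hθ.pos c
    · have := mul_nonneg (sub_nonneg.2 h1) (hθ.pos c).le
      have := mul_pos h0 (hη.pos c)
      linarith
  refine ⟨hpos, fun f => ?_⟩
  have : faceSum T (θ + t • (η - θ)) f = Real.pi := by
    simp [hθ.faceSum_eq, hη.faceSum_eq]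
  exact this

/-- The second derivative of the energy is a negative definite form on every triangle. -/
theorem sum_cot_pos (hθ : IsAngleStructure T θ) {w : Corner T → ℝ} (hw : faceSum T w = 0)
    (hne : w ≠ 0) : 0 < ∑ c, Real.cos (θ c) / Real.sin (θ c) * w c ^ 2 := by
  have key : ∀ c : Corner T, 0 ≤ ∑ d : Corner T with d.face = c.face,
      Real.cos (θ d) / Real.sin (θ d) * w d ^ 2 ∧ (w c ≠ 0 →
      0 < ∑ d : Corner T with d.face = c.face,
        Real.cos (θ d) / Real.sin (θ d) * w d ^ 2) := by
    intro c
    obtain ⟨d, e, hcd, hce, hde, hf, -, -⟩ := c.exists_triple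
    have hc : c ∉ ({d, e} : Finset (Corner T)) := by simp [hcd, hce]
    have hs := hθ.sum_face c.face
    have hs' : ∑ d : Corner T with d.face = c.face, w d = 0 := congrFun hw c.face
    rw [hf, Finset.sum_insert hc, Finset.sum_pair hde, ← add_assoc] at hs hs' ⊢
    by_cases h : w c = 0 ∧ w d = 0 ∧ w e = 0
    · simp [h.1, h.2.1, h.2.2]
    · have := cot_quadratic_pos (hθ.pos c) (hθ.pos d) (hθ.pos e) hs hs' h
      exact ⟨this.le, fun _ => this⟩
  obtain ⟨c, hc⟩ := Function.ne_iff.1 hne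
  rw [sum_corners_eq_sum_faces]
  refine Finset.sum_pos' (fun f _ => ?_) ⟨c.face, Finset.mem_univ _, (key c).2 hc⟩
  obtain ⟨d, rfl⟩ := f.exists_corner
  exact (key d).1

/-- Along the segment between two critical points the derivative of the energy is strictly
decreasing, while it vanishes at both ends. -/
theorem IsCriticalPoint.unique (hθ : IsCriticalPoint T a θ) (hη : IsCriticalPoint T a η) :
    θ = η := by
  by_contra hne
  rw [isCriticalPoint_iff] at hθ hη
  obtain ⟨⟨hθs, hθa⟩, hθc⟩ := hθ
  obtain ⟨⟨hηs, hηa⟩, hηc⟩ := hη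
  set w := η - θ with hw
  have hw0 : w ≠ 0 := sub_ne_zero.2 (Ne.symm hne)
  have hwf : faceSum T w = 0 := by rw [hw, map_sub, hθs.faceSum_eq, hηs.faceSum_eq, sub_self]
  have hwe : edgeInvariant T w = 0 := by
    rw [hw, ← edgeInvariantLinear_apply, map_sub]
    simp [edgeInvariantLinear_apply, hθa, hηa]
  let G : ℝ → ℝ := fun t => ∑ c, Real.log (2 * Real.sin (θ c + t * w c)) * w c
  have hG : ∀ t ∈ Set.Icc (0 : ℝ) 1, HasDerivAt G
      (∑ c, Real.cos (θ c + t * w c) / Real.sin (θ c + t * w c) * w c ^ 2) t := by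
    intro t ht
    refine HasDerivAt.fun_sum fun c _ => ?_
    have hs : 0 < Real.sin (θ c + t * w c) := (hθs.lineMap hηs ht.1 ht.2).sin_pos c
    have h1 : HasDerivAt (fun t : ℝ => θ c + t * w c) (w c) t := by
      simpa using ((hasDerivAt_id t).mul_const (w c)).const_add (θ c)
    have h2 := ((h1.sin.const_mul 2).log (by positivity)).mul_const (w c)
    rw [mul_div_mul_left _ _ two_ne_zero] at h2
    rwa [show Real.cos (θ c + t * w c) / Real.sin (θ c + t * w c) * w c ^ 2 =
      Real.cos (θ c + t * w c) * w c / Real.sin (θ c + t * w c) * w c by ring]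
  have hmono : StrictMonoOn G (Set.Icc 0 1) := by
    refine strictMonoOn_of_deriv_pos (convex_Icc _ _)
      (fun t ht => (hG t ht).continuousAt.continuousWithinAt) fun t ht => ?_
    have ht' := interior_subset ht
    rw [(hG t ht').deriv]
    exact sum_cot_pos (hθs.lineMap hηs ht'.1 ht'.2) hwf hw0
  have h01 := hmono (Set.left_mem_Icc.2 zero_le_one) (Set.right_mem_Icc.2 zero_le_one) one_pos
  have h0 : G 0 = 0 := by simpa [G] using hθc w hwf hwe
  have h1 : G 1 = 0 := by simpa [G, hw] using hηc w hwf hwe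
  linarith

/-! ### Maximizers of the energy -/

variable (T) in
/-- The angle structures in the wide sense, in which angles may vanish. -/
def closedAngles : Set (Corner T → ℝ) :=
  {θ | (∀ c, 0 ≤ θ c) ∧ faceSum T θ = fun _ => Real.pi}

theorem IsAngleStructure.mem_closedAngles (h : IsAngleStructure T θ) : θ ∈ closedAngles T :=
  ⟨fun c => (h.pos c).le, h.faceSum_eq⟩

theorem isCompact_closedAngles : IsCompact (closedAngles T) := by
  refine (isCompact_Icc (a := (0 : Corner T → ℝ)) (b := fun _ => Real.pi)).of_isClosed_subset
    ?_ ?_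
  · have h : closedAngles T = (⋂ c, {θ : Corner T → ℝ | 0 ≤ θ c}) ∩
        {θ | faceSum T θ = fun _ => Real.pi} := by
      ext θ
      simp [closedAngles]
    rw [h]
    exact (isClosed_iInter fun c => isClosed_le continuous_const (continuous_apply c)).inter
      (isClosed_eq (faceSum T).continuous_of_finiteDimensional continuous_const)
  · rintro θ ⟨h0, hs⟩
    refine ⟨h0, fun c => ?_⟩
    have : ∑ d : Corner T with d.face = c.face, θ d = Real.pi := congrFun hs c.face
    change θ c ≤ Real.pi
    rw [← this]
    exact Finset.single_le_sum (f := θ) (fun d _ => h0 d) (by simp)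

/-- A sum of angles opposite to an edge that is less than `π` keeps every angle away from `π`, even
when angles are allowed to vanish. This excludes the degenerate triangles `(0, 0, π)`. -/
theorem lt_pi_of_edgeInvariant (h : ∀ c, 0 ≤ θ c) (hlt : ∀ i, edgeInvariant T θ i < Real.pi)
    (c : Corner T) : θ c < Real.pi := by
  refine lt_of_le_of_lt ?_ (hlt (Sum.inl c.opposite))
  exact Finset.single_le_sum (f := θ) (fun d _ => h d) (by simp)

/-- The derivative of the energy is infinite at a vanishing angle, in every direction that makes
all the vanishing angles positive, as long as no angle equals `π`. -/
theorem exists_energy_lt {θ₀ : Corner T → ℝ} (h0 : ∀ c, 0 ≤ θ c) (hpi : ∀ c, θ c < Real.pi)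
    (hθ₀ : IsAngleStructure T θ₀) {c₀ : Corner T} (hc₀ : θ c₀ = 0) :
    ∃ t ∈ Set.Icc (0 : ℝ) 1, energy T θ < energy T (θ + t • (θ₀ - θ)) := by
  set w := θ₀ - θ with hw
  have hmem : ∀ t ∈ Set.Ioo (0 : ℝ) 1, ∀ c, 0 < Real.sin (θ c + t * w c) := by
    intro t ht c
    have e : θ c + t * w c = (1 - t) * θ c + t * θ₀ c := by
      rw [hw, Pi.sub_apply]
      ring
    have h1 := mul_nonneg (sub_nonneg.2 ht.2.le) (h0 c)
    have h2 := mul_pos ht.1 (hθ₀.pos c)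
    have h3 := mul_lt_mul_of_pos_left (hpi c) (sub_pos.2 ht.2)
    have h4 := mul_lt_mul_of_pos_left (hθ₀.lt_pi c) ht.1
    apply Real.sin_pos_of_pos_of_lt_pi <;> rw [e] <;> linarith
  let D : Corner T → ℝ → ℝ := fun c t => -Real.log (2 * Real.sin (θ c + t * w c)) * w c
  have hIoo : Set.Ioo (0 : ℝ) 1 ∈ 𝓝[>] (0 : ℝ) := Ioo_mem_nhdsGT one_pos
  have hzero : ∀ c, θ c = 0 → Filter.Tendsto (D c) (𝓝[>] 0) Filter.atTop := by
    intro c hc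
    have hwc : 0 < w c := by simpa [hw, hc] using hθ₀.pos c
    have hcont : Continuous fun t : ℝ => 2 * Real.sin (θ c + t * w c) := by fun_prop
    have h1 : Filter.Tendsto (fun t : ℝ => 2 * Real.sin (θ c + t * w c)) (𝓝[>] 0) (𝓝[>] 0) := by
      refine tendsto_nhdsWithin_iff.2 ⟨?_, ?_⟩
      · have := hcont.tendsto 0
        simp only [hc, zero_mul, add_zero, Real.sin_zero, mul_zero] at this ⊢
        exact this.mono_left nhdsWithin_le_nhds
      · filter_upwards [hIoo] with t ht
        have := hmem t ht c
        simpa using this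
    have h2 := Filter.tendsto_neg_atBot_atTop.comp (Real.tendsto_log_nhdsGT_zero.comp h1)
    exact h2.atTop_mul_const hwc
  have hbdd : ∀ c, ∃ m, ∀ᶠ t in 𝓝[>] (0 : ℝ), m ≤ D c t := by
    intro c
    rcases (h0 c).eq_or_lt with hc | hc
    · exact ⟨0, (hzero c hc.symm).eventually_ge_atTop 0⟩
    · have hs : 0 < Real.sin (θ c) := Real.sin_pos_of_pos_of_lt_pi hc (hpi c)
      have hcont : ContinuousAt (D c) 0 := by
        refine ContinuousAt.mul (ContinuousAt.neg (ContinuousAt.log (by fun_prop) ?_)) (by fun_prop)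
        simp [hs.ne']
      refine ⟨D c 0 - 1, nhdsWithin_le_nhds ?_⟩
      exact (hcont.eventually (lt_mem_nhds (sub_one_lt _))).mono fun _ h => h.le
  choose m hm using hbdd
  have htop : Filter.Tendsto (fun t => ∑ c, D c t) (𝓝[>] 0) Filter.atTop := by
    have h1 : ∀ t, ∑ c, D c t = D c₀ t + ∑ c ∈ Finset.univ.erase c₀, D c t := fun t =>
      (Finset.add_sum_erase _ _ (Finset.mem_univ c₀)).symm
    simp only [h1]
    refine Filter.tendsto_atTop_add_right_of_le' _ (∑ c ∈ Finset.univ.erase c₀, m c)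
      (hzero c₀ hc₀) ?_
    filter_upwards [Filter.eventually_all.2 hm] with t ht
    exact Finset.sum_le_sum fun c _ => ht c
  obtain ⟨δ, hδ, hpos⟩ := (mem_nhdsGT_iff_exists_Ioo_subset' (one_pos (α := ℝ))).1
    ((htop.eventually_gt_atTop 0).and hIoo)
  have hδ' : (0 : ℝ) < δ := hδ
  have hmono : StrictMonoOn (fun t : ℝ => energy T (θ + t • w)) (Set.Icc 0 (δ / 2)) := by
    refine strictMonoOn_of_deriv_pos (convex_Icc _ _)
      (continuous_energy.comp (by fun_prop)).continuousOn fun t ht => ?_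
    rw [interior_Icc] at ht
    obtain ⟨h1, h2⟩ := hpos ⟨ht.1, by linarith [ht.2]⟩
    rw [(hasDerivAt_energy (hmem t h2)).deriv]
    exact h1
  have h2 := hpos (a := δ / 2) ⟨half_pos hδ', by linarith⟩
  refine ⟨δ / 2, ⟨h2.2.1.le, h2.2.2.le⟩, ?_⟩
  simpa using hmono (Set.left_mem_Icc.2 (by positivity)) (Set.right_mem_Icc.2 (by positivity))
    (half_pos hδ')

/-- A maximizer of the energy over the closed fibre has no vanishing angle, hence is critical. -/
theorem isCriticalPoint_of_forall_le {θ₀ : Corner T → ℝ} (hθ₀ : θ₀ ∈ A0 T)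
    (hθ : θ ∈ closedAngles T) (he : edgeInvariant T θ = edgeInvariant T θ₀)
    (hmax : ∀ η ∈ closedAngles T, edgeInvariant T η = edgeInvariant T θ₀ →
      energy T η ≤ energy T θ) :
    IsCriticalPoint T (edgeInvariant T θ₀) θ := by
  have hpi : ∀ c, θ c < Real.pi :=
    lt_pi_of_edgeInvariant hθ.1 fun i => he ▸ (hθ₀.2.1 i).2
  have hpos : ∀ c, 0 < θ c := by
    intro c
    refine (hθ.1 c).lt_of_ne' fun hc => ?_
    obtain ⟨t, ht, hlt⟩ := exists_energy_lt hθ.1 hpi hθ₀.1 hc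
    refine hlt.not_ge (hmax _ ⟨fun d => ?_, ?_⟩ ?_)
    · have e : (θ + t • (θ₀ - θ)) d = (1 - t) * θ d + t * θ₀ d := by
        simp
        ring
      rw [e]
      exact add_nonneg (mul_nonneg (sub_nonneg.2 ht.2) (hθ.1 d))
        (mul_nonneg ht.1 (hθ₀.1.pos d).le)
    · simp [hθ.2, hθ₀.1.faceSum_eq]
    · rw [← edgeInvariantLinear_apply]
      simp only [map_add, map_sub, map_smul]
      simp [edgeInvariantLinear_apply, he]
  have hs : IsAngleStructure T θ := ⟨hpos, congrFun hθ.2⟩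
  refine ⟨⟨hs, he⟩, fun w hwf hwe => ?_⟩
  have hwf' : faceSum T w = 0 := funext hwf
  have hd := hasDerivAt_energy (θ := θ) (w := w) (t := 0) (fun c => by simpa using hs.sin_pos c)
  have hloc : IsLocalMax (fun t : ℝ => energy T (θ + t • w)) 0 := by
    have hev : ∀ c, ∀ᶠ t in 𝓝 (0 : ℝ), 0 < θ c + t * w c := by
      intro c
      have : ContinuousAt (fun t : ℝ => θ c + t * w c) 0 := by fun_prop
      exact this.eventually (lt_mem_nhds (by simpa using hpos c))
    filter_upwards [Filter.eventually_all.2 hev] with t ht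
    have : energy T (θ + t • w) ≤ energy T θ := by
      refine hmax _ ⟨fun c => (ht c).le, ?_⟩ ?_
      · simp [hwf', hθ.2]
      · rw [← edgeInvariantLinear_apply]
        simp only [map_add, map_smul]
        simp [edgeInvariantLinear_apply, hwe, he]
    simpa using this
  rwa [hloc.hasDerivAt_eq_zero hd] at hd

theorem exists_isCriticalPoint (ha : a ∈ edgeInvariant T '' A0 T) :
    ∃ θ, IsCriticalPoint T a θ ∧
      ∀ η ∈ closedAngles T, edgeInvariant T η = a → energy T η ≤ energy T θ := by
  obtain ⟨θ₀, hθ₀, rfl⟩ := ha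
  have hK : IsCompact (closedAngles T ∩ {θ | edgeInvariant T θ = edgeInvariant T θ₀}) :=
    isCompact_closedAngles.inter_right
      (isClosed_eq (edgeInvariantLinear T).continuous_of_finiteDimensional continuous_const)
  obtain ⟨θ, hθ, hmax⟩ := hK.exists_isMaxOn ⟨θ₀, hθ₀.1.mem_closedAngles, rfl⟩
    continuous_energy.continuousOn
  exact ⟨θ, isCriticalPoint_of_forall_le hθ₀ hθ.1 hθ.2 fun η h1 h2 => hmax ⟨h1, h2⟩,
    fun η h1 h2 => hmax ⟨h1, h2⟩⟩

/-! ### Dependence of the critical point on the edge invariant -/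

/-- The critical point of the energy among the angle structures with a given edge invariant. -/
def criticalPoint (a : edgeInvariant T '' A0 T) : Corner T → ℝ :=
  (exists_isCriticalPoint a.2).choose

theorem isCriticalPoint_criticalPoint (a : edgeInvariant T '' A0 T) :
    IsCriticalPoint T a.1 (criticalPoint a) :=
  (exists_isCriticalPoint a.2).choose_spec.1

theorem energy_le_energy_criticalPoint (a : edgeInvariant T '' A0 T) (hη : η ∈ closedAngles T)
    (he : edgeInvariant T η = a.1) : energy T η ≤ energy T (criticalPoint a) :=
  (exists_isCriticalPoint a.2).choose_spec.2 η hη he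

theorem isCriticalPoint_iff_eq_criticalPoint (a : edgeInvariant T '' A0 T) :
    IsCriticalPoint T a.1 θ ↔ θ = criticalPoint a :=
  ⟨fun h => h.unique (isCriticalPoint_criticalPoint a),
    fun h => h ▸ isCriticalPoint_criticalPoint a⟩

theorem criticalPoint_mem_AE (a : edgeInvariant T '' A0 T) : criticalPoint a ∈ AE T := by
  have h := isCriticalPoint_criticalPoint a
  refine mem_AE_of_isCriticalPoint h ?_
  obtain ⟨_, θ₀, hθ₀, rfl⟩ := a
  exact anglesWithInvariant_subset_A0 hθ₀ h.1

/-- Every limit of critical points maximizes the energy in its fibre: a maximizer over `a` moves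
continuously into the nearby fibres along a linear section of the edge invariant. -/
theorem continuous_criticalPoint :
    Continuous (criticalPoint : edgeInvariant T '' A0 T → Corner T → ℝ) := by
  rw [continuous_iff_ultrafilter]
  intro a g hg
  let f := (edgeInvariantLinear T).domRestrict (LinearMap.ker (faceSum T))
  obtain ⟨r, hr⟩ := f.rangeRestrict.exists_rightInverse_of_surjective f.range_rangeRestrict
  obtain ⟨s, hs⟩ := LinearMap.exists_extend r
  have hsr : ∀ w : LinearMap.ker (faceSum T),
      edgeInvariant T (s (edgeInvariant T w.1)).1 = edgeInvariant T w.1 := by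
    intro w
    have h1 := LinearMap.congr_fun hs (f.rangeRestrict w)
    have h2 := congrArg Subtype.val (LinearMap.congr_fun hr (f.rangeRestrict w))
    rwa [LinearMap.comp_apply, ← h1] at h2
  have hcrit := fun b : edgeInvariant T '' A0 T => isCriticalPoint_criticalPoint b
  -- `p b` is a point of the fibre over `b`, positive for `b` near `a`, with `p a` critical.
  let p : edgeInvariant T '' A0 T → Corner T → ℝ :=
    fun b => criticalPoint a + (s (b.1 - a.1)).1
  have hpc : Continuous p := by
    have : Continuous s := s.continuous_of_finiteDimensional
    fun_prop
  have hpa : p a = criticalPoint a := by simp [p]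
  have hpe : ∀ b, edgeInvariant T (p b) = b.1 := by
    intro b
    have hk : criticalPoint b - criticalPoint a ∈ LinearMap.ker (faceSum T) := by
      rw [LinearMap.mem_ker, map_sub, (hcrit b).1.1.faceSum_eq, (hcrit a).1.1.faceSum_eq, sub_self]
    have h1 := hsr ⟨_, hk⟩
    have h2 : edgeInvariant T (criticalPoint b - criticalPoint a) = b.1 - a.1 := by
      rw [← edgeInvariantLinear_apply, map_sub, edgeInvariantLinear_apply,
        edgeInvariantLinear_apply, (hcrit b).1.2, (hcrit a).1.2]
    rw [h2] at h1
    simp only [p]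
    rw [← edgeInvariantLinear_apply, map_add, edgeInvariantLinear_apply,
      edgeInvariantLinear_apply, h1, (hcrit a).1.2, add_sub_cancel]
  have hpf : ∀ b, faceSum T (p b) = fun _ => Real.pi := by
    intro b
    rw [map_add, (hcrit a).1.1.faceSum_eq, LinearMap.mem_ker.1 (s (b.1 - a.1)).2, add_zero]
  have hev : ∀ᶠ b in 𝓝 a, energy T (p b) ≤ energy T (criticalPoint b) := by
    have h : ∀ c, ∀ᶠ b in 𝓝 a, 0 < p b c := fun c =>
      ((continuous_apply c).comp hpc).continuousAt.eventually
        (lt_mem_nhds (by simpa [hpa] using (hcrit a).1.1.pos c))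
    filter_upwards [Filter.eventually_all.2 h] with b hb
    exact energy_le_energy_criticalPoint b ⟨fun c => (hb c).le, hpf b⟩ (hpe b)
  obtain ⟨θ, hθ, hlim⟩ := isCompact_closedAngles.ultrafilter_le_nhds (g.map criticalPoint)
    (Filter.le_principal_iff.2 (Filter.mem_map.2
      (Filter.univ_mem' fun b => (hcrit b).1.1.mem_closedAngles)))
  have hlim' : Filter.Tendsto criticalPoint (g : Filter (edgeInvariant T '' A0 T)) (𝓝 θ) := hlim
  have hθa : edgeInvariant T θ = a.1 := by
    have h1 := ((edgeInvariantLinear T).continuous_of_finiteDimensional.tendsto θ).comp hlim'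
    have h2 : Filter.Tendsto (fun b : edgeInvariant T '' A0 T => b.1) g (𝓝 a.1) :=
      (continuous_subtype_val.tendsto a).mono_left hg
    refine tendsto_nhds_unique h1 (h2.congr fun b => ?_)
    exact (hcrit b).1.2.symm
  have hle : energy T (criticalPoint a) ≤ energy T θ := by
    have h1 := (continuous_energy.tendsto θ).comp hlim'
    have h2 := ((continuous_energy.comp hpc).tendsto a).mono_left hg
    rw [Function.comp_apply, hpa] at h2
    exact le_of_tendsto_of_tendsto h2 h1 (hg hev)
  have hcr : IsCriticalPoint T a.1 θ := by
    obtain ⟨θ₀, hθ₀, ha⟩ := a.2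
    rw [← ha] at hθa ⊢
    refine isCriticalPoint_of_forall_le hθ₀ hθ hθa fun η h1 h2 => ?_
    exact (energy_le_energy_criticalPoint a h1 (h2.trans ha)).trans hle
  rw [(isCriticalPoint_iff_eq_criticalPoint a).1 hcr] at hlim'
  exact hlim'

variable (T) in
/-- The critical point map, with inverse the restriction of the edge invariant. -/
def criticalPointHomeomorph : edgeInvariant T '' A0 T ≃ₜ AE T where
  toFun a := ⟨criticalPoint a, criticalPoint_mem_AE a⟩
  invFun θ := ⟨edgeInvariant T θ.1, θ.1, θ.2.1, rfl⟩
  left_inv a := Subtype.ext (isCriticalPoint_criticalPoint a).1.2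
  right_inv θ := Subtype.ext
    ((isCriticalPoint_iff_eq_criticalPoint _).1 (isCriticalPoint_of_mem_AE θ.2)).symm
  continuous_toFun := continuous_criticalPoint.subtype_mk _
  continuous_invFun := ((edgeInvariantLinear T).continuous_of_finiteDimensional.comp
    continuous_subtype_val).subtype_mk _

/-! ### The set of edge invariants is an open cell -/

theorem nonempty_homeomorph_euclideanSpace {E : Type*} [NormedAddCommGroup E] [NormedSpace ℝ E]
    [FiniteDimensional ℝ E] {s : Set E} (hc : Convex ℝ s) (ho : IsOpen s) (hne : s.Nonempty)
    (hb : Bornology.IsBounded s) :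
    Nonempty (s ≃ₜ EuclideanSpace ℝ (Fin (Module.finrank ℝ E))) := by
  obtain ⟨h, hs, -, -⟩ := exists_homeomorph_image_interior_closure_frontier_eq_unitBall hc
    (by rwa [ho.interior_eq]) hb
  rw [ho.interior_eq] at hs
  exact ⟨(h.image s).trans ((Homeomorph.setCongr hs).trans
    (Homeomorph.unitBall.symm.trans toEuclidean.toHomeomorph))⟩

variable (T) in
/-- The directions of the affine space cut out by the angle sums of the triangles and of the
interior vertices. -/
def tangentSpace : Submodule ℝ (Corner T → ℝ) where
  carrier := {w | faceSum T w = 0 ∧ ∀ v, IsInteriorVertex T v → angleSum T w v = 0}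
  zero_mem' := by simp [angleSum]
  add_mem' {x y} hx hy := by
    refine ⟨by rw [map_add, hx.1, hy.1, add_zero], fun v hv => ?_⟩
    have h1 := hx.2 v hv
    have h2 := hy.2 v hv
    rw [angleSum] at h1 h2 ⊢
    simp [Finset.sum_add_distrib, h1, h2]
  smul_mem' r x hx := by
    refine ⟨by rw [map_smul, hx.1, smul_zero], fun v hv => ?_⟩
    have h1 := hx.2 v hv
    rw [angleSum] at h1 ⊢
    simp [← Finset.mul_sum, h1]

theorem add_mem_A0_iff (hθ : θ ∈ A0 T) (w : tangentSpace T) :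
    θ + w.1 ∈ A0 T ↔ (∀ c, 0 < θ c + w.1 c) ∧
      ∀ i, edgeInvariant T θ i + edgeInvariant T w.1 i ∈ Set.Ioo 0 Real.pi := by
  have he : edgeInvariant T (θ + w.1) = edgeInvariant T θ + edgeInvariant T w.1 :=
    map_add (edgeInvariantLinear T) _ _
  constructor
  · rintro ⟨h1, h2, -⟩
    refine ⟨h1.pos, fun i => ?_⟩
    have := h2 i
    rwa [he] at this
  · rintro ⟨h1, h2⟩
    refine ⟨⟨h1, fun f => ?_⟩, fun i => by rw [he]; exact h2 i, fun v hv => ?_⟩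
    · have : faceSum T (θ + w.1) f = Real.pi := by
        rw [map_add, w.2.1, hθ.1.faceSum_eq, add_zero]
      exact this
    · have h3 := hθ.2.2 v hv
      have h4 := w.2.2 v hv
      rw [angleSum] at h3 h4 ⊢
      simp only [Pi.add_apply, Finset.sum_add_distrib, h3, h4, add_zero]

theorem sub_mem_tangentSpace (hθ : θ ∈ A0 T) (hη : η ∈ A0 T) : η - θ ∈ tangentSpace T := by
  refine ⟨by rw [map_sub, hθ.1.faceSum_eq, hη.1.faceSum_eq, sub_self], fun v hv => ?_⟩
  have h1 := hθ.2.2 v hv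
  have h2 := hη.2.2 v hv
  rw [angleSum] at h1 h2 ⊢
  simp only [Pi.sub_apply, Finset.sum_sub_distrib, h1, h2, sub_self]

/-- The image of `A_0` under the edge invariant is, up to a translation, a bounded convex open subset
of the image of the tangent space. -/
theorem exists_homeomorph_image_A0 (hne : (A0 T).Nonempty) :
    ∃ k : ℕ, Nonempty (edgeInvariant T '' A0 T ≃ₜ EuclideanSpace ℝ (Fin k)) := by
  obtain ⟨θ, hθ⟩ := hne
  have : Fintype (BoundaryVertex T) := Fintype.ofFinite _
  let f := (edgeInvariantLinear T).domRestrict (tangentSpace T)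
  have hf : ∀ w, f w = edgeInvariant T w.1 := fun w => rfl
  let U : Set (tangentSpace T) := {w | (∀ c, 0 < θ c + w.1 c) ∧
    ∀ i, edgeInvariant T θ i + f w i ∈ Set.Ioo 0 Real.pi}
  have hU : ∀ w, w ∈ U ↔ θ + w.1 ∈ A0 T := fun w => (add_mem_A0_iff hθ w).symm
  have hUo : IsOpen U := by
    have hfc : Continuous f := f.continuous_of_finiteDimensional
    have e : U = (⋂ c, {w | 0 < θ c + w.1 c}) ∩
        ⋂ i, (fun w => edgeInvariant T θ i + f w i) ⁻¹' Set.Ioo 0 Real.pi := by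
      ext w
      simp [U]
    rw [e]
    refine (isOpen_iInter_of_finite fun c => isOpen_lt continuous_const ?_).inter
      (isOpen_iInter_of_finite fun i => isOpen_Ioo.preimage ?_)
    · exact continuous_const.add ((continuous_apply c).comp continuous_subtype_val)
    · exact continuous_const.add ((continuous_apply i).comp hfc)
  have hUc : Convex ℝ U := by
    have e : U = (⋂ c, (LinearMap.proj c ∘ₗ (tangentSpace T).subtype) ⁻¹' Set.Ioi (-θ c)) ∩
        ⋂ i, (LinearMap.proj i ∘ₗ f) ⁻¹'
          Set.Ioo (-edgeInvariant T θ i) (Real.pi - edgeInvariant T θ i) := by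
      ext w
      simp [U, neg_lt_iff_pos_add', lt_sub_iff_add_lt']
    rw [e]
    exact (convex_iInter fun c => (convex_Ioi _).linear_preimage _).inter
      (convex_iInter fun i => (convex_Ioo _ _).linear_preimage _)
  let S := f.rangeRestrict '' U
  have hS : ∀ x ∈ S, ∀ i, edgeInvariant T θ i + x.1 i ∈ Set.Ioo 0 Real.pi := by
    rintro _ ⟨w, hw, rfl⟩ i
    exact hw.2 i
  have hSb : Bornology.IsBounded S := by
    have hI : Bornology.IsBounded (Set.Icc (-edgeInvariant T θ)
        ((fun _ => Real.pi) - edgeInvariant T θ)) := Metric.isBounded_Icc _ _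
    refine (isometry_subtype_coe.antilipschitz.isBounded_preimage hI).subset fun x hx => ?_
    refine ⟨fun i => ?_, fun i => ?_⟩
    · have := (hS x hx i).1
      simp only [Pi.neg_apply]
      linarith
    · have := (hS x hx i).2
      simp only [Pi.sub_apply]
      linarith
  have hSo : IsOpen S :=
    f.rangeRestrict.isOpenMap_of_finiteDimensional f.surjective_rangeRestrict U hUo
  have hSn : S.Nonempty := ⟨_, 0, (hU 0).2 (by simpa using hθ), rfl⟩
  obtain ⟨φ⟩ := nonempty_homeomorph_euclideanSpace (hUc.linear_image f.rangeRestrict) hSo hSn hSb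
  have hemb : Topology.IsEmbedding (fun x : LinearMap.range f => edgeInvariant T θ + x.1) :=
    (Homeomorph.addLeft (edgeInvariant T θ)).isEmbedding.comp Topology.IsEmbedding.subtypeVal
  have himg : (fun x : LinearMap.range f => edgeInvariant T θ + x.1) '' S =
      edgeInvariant T '' A0 T := by
    ext b
    constructor
    · rintro ⟨_, ⟨w, hw, rfl⟩, rfl⟩
      exact ⟨θ + w.1, (hU w).1 hw, map_add (edgeInvariantLinear T) _ _⟩
    · rintro ⟨η, hη, rfl⟩
      refine ⟨_, ⟨⟨η - θ, sub_mem_tangentSpace hθ hη⟩, (hU _).2 (by simpa using hη), rfl⟩, ?_⟩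
      change edgeInvariantLinear T θ + edgeInvariantLinear T (η - θ) = edgeInvariantLinear T η
      rw [map_sub, add_sub_cancel]
  exact ⟨_, ⟨((hemb.homeomorphImage S).trans (Homeomorph.setCongr himg)).symm.trans φ⟩⟩

end TriangulatedSurface
end

theorem lemma2p2 {V : Type*} [Fintype V] [DecidableEq V] (T : AbstractSimplicialComplex V)
    (hT : TriangulatedSurface.IsSurface T) (hne : (TriangulatedSurface.AE T).Nonempty) :
    (∃ k : ℕ, Nonempty (TriangulatedSurface.AE T ≃ₜ EuclideanSpace ℝ (Fin k))) ∧
    ∃ Θ : (TriangulatedSurface.edgeInvariant T '' TriangulatedSurface.A0 T) ≃ₜ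
        TriangulatedSurface.AE T,
      ∀ (a : TriangulatedSurface.edgeInvariant T '' TriangulatedSurface.A0 T)
        (θ : TriangulatedSurface.Corner T → ℝ),
        TriangulatedSurface.IsCriticalPoint T a.1 θ ↔ θ = (Θ a).1 := by
  obtain ⟨k, ⟨φ⟩⟩ := TriangulatedSurface.exists_homeomorph_image_A0 (hne.mono fun _ h => h.1)
  exact ⟨⟨k, ⟨(TriangulatedSurface.criticalPointHomeomorph T).symm.trans φ⟩⟩,
    TriangulatedSurface.criticalPointHomeomorph T,
    fun a _ => TriangulatedSurface.isCriticalPoint_iff_eq_criticalPoint a⟩
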